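/- Let $M$ be a compact $C^1$ manifold (without boundary, not necessarily connected) with a continuous Riemannian metric, and let $\mathrm{dist}$ be the Riemannian distance (the infimum of the lengths of $C^1$ paths; it equals $\infty$ for points in different components). Let $f:M\to M$ be an Anosov diffeomorphism, that is, a $C^1$ diffeomorphism for which there are constants $K>0$, $0<\lambda<1$ and subspaces $S_x,U_x\subset T_xM$, varying continuously with $x$, such that for all $x\in M$: $S_x\oplus U_x=T_xM$; $f'_xS_x=S_{f(x)}$ and $f'_xU_x=U_{f(x)}$; $\|(f^n)'_xs\|\le K\lambda^n\|s\|$ for all $s\in S_x$, $n\ge 0$; and $\|(f^{n})'_xu\|\le K\lambda^{-n}\|u\|$ for all $u\in U_x$, $n\le 0$. Let $\rho>0$ be an expansivity constant of $f$: for $x,y\in M$, $\mathrm{dist}(f^nx,f^ny)\le\rho$ for all $n\in\mathbb Z$ if and only if $x=y$. For $\varepsilon>0$ put $$W^s_\varepsilon(x)=\{y\in M:\mathrm{dist}(f^nx,f^ny)\le\varepsilon\ \ \forall n\ge0\},\qquad W^u_\varepsilon(x)=\{y\in M:\mathrm{dist}(f^nx,f^ny)\le\varepsilon\ \ \forall n\le0\}.$$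 Let $0<\varepsilon\le\rho/2$. Then: 1. There is $\delta>0$ such that for all $x,y\in M$ with $\mathrm{dist}(x,y)<\delta$ the set $W^s_\varepsilon(x)\cap W^u_\varepsilon(y)$ consists of exactly one point. 2. For every $\delta>0$ with the property in 1, the bracket map $[\cdot,\cdot]:\{(x,y)\in M^2:\mathrm{dist}(x,y)<\delta\}\to M$, where $[x,y]$ is the unique point of $W^s_\varepsilon(x)\cap W^u_\varepsilon(y)$, is continuous. -/

import Mathlib

open Set Filter Topology Bundle
open scoped Manifold ENNReal

noncomputable section

namespace AnosovBracket

section Smooth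

variable {E : Type*} [NormedAddCommGroup E] [NormedSpace ℝ E]
  {M : Type*} [TopologicalSpace M] [ChartedSpace E M]

/-- The iterate `f ^ n` of a `C^1` diffeomorphism, for `n : ℤ` (negative `n` gives iterates of the
inverse). -/
def iter (f : M ≃ₘ^1⟮𝓘(ℝ, E), 𝓘(ℝ, E)⟯ M) (n : ℤ) : M → M :=
  ⇑((f.toEquiv : Equiv.Perm M) ^ n)

variable [IsManifold 𝓘(ℝ, E) 1 M]

/-- A field of subspaces `S x ⊆ T_x M` varies continuously with `x`: near every point it is spanned
by a continuous frame, i.e. by finitely many continuous local vector fields which form a basis of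
`S x` at every point `x` of the neighbourhood. -/
def IsContinuousSubspaceField (S : ∀ x : M, Submodule ℝ (TangentSpace 𝓘(ℝ, E) x)) : Prop :=
  ∀ x₀ : M, ∃ V ∈ 𝓝 x₀, ∃ (k : ℕ) (v : Fin k → ∀ x : M, TangentSpace 𝓘(ℝ, E) x),
    (∀ i, ContinuousOn (fun x => (⟨x, v i x⟩ : TangentBundle 𝓘(ℝ, E) M)) V) ∧
    ∀ x ∈ V, LinearIndependent ℝ (fun i => v i x) ∧
      Submodule.span ℝ (range fun i => v i x) = S x

variable [RiemannianBundle (fun x : M => TangentSpace 𝓘(ℝ, E) x)]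

/-- `f` is an Anosov diffeomorphism; the norm on the tangent spaces is the one of the Riemannian
metric. In the last condition `u` is contracted by the negative iterates `f ^ (-n)`, `n ≥ 0`. -/
def IsAnosov (f : M ≃ₘ^1⟮𝓘(ℝ, E), 𝓘(ℝ, E)⟯ M) : Prop :=
  ∃ (K lam : ℝ) (S U : ∀ x : M, Submodule ℝ (TangentSpace 𝓘(ℝ, E) x)),
    0 < K ∧ 0 < lam ∧ lam < 1 ∧
    IsContinuousSubspaceField S ∧ IsContinuousSubspaceField U ∧
    (∀ x, IsCompl (S x) (U x)) ∧
    (∀ x, (S x).map (mfderiv 𝓘(ℝ, E) 𝓘(ℝ, E) f x).toLinearMap = S (f x)) ∧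
    (∀ x, (U x).map (mfderiv 𝓘(ℝ, E) 𝓘(ℝ, E) f x).toLinearMap = U (f x)) ∧
    (∀ (x : M) (n : ℕ), ∀ s ∈ S x,
      ‖mfderiv 𝓘(ℝ, E) 𝓘(ℝ, E) (iter f n) x s‖ ≤ K * lam ^ n * ‖s‖) ∧
    (∀ (x : M) (n : ℕ), ∀ u ∈ U x,
      ‖mfderiv 𝓘(ℝ, E) 𝓘(ℝ, E) (iter f (-(n : ℤ))) x u‖ ≤ K * lam ^ n * ‖u‖)

end Smooth

section Metric

variable {E : Type*} [NormedAddCommGroup E] [NormedSpace ℝ E]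
  {M : Type*} [EMetricSpace M] [ChartedSpace E M]

/-- `ρ` is an expansivity constant of `f`. -/
def IsExpansivityConstant (f : M ≃ₘ^1⟮𝓘(ℝ, E), 𝓘(ℝ, E)⟯ M) (ρ : ℝ) : Prop :=
  0 < ρ ∧ ∀ x y : M, (∀ n : ℤ, edist (iter f n x) (iter f n y) ≤ ENNReal.ofReal ρ) ↔ x = y

/-- The `ε`-stable set `W^s_ε(x)`. -/
def stableSet (f : M ≃ₘ^1⟮𝓘(ℝ, E), 𝓘(ℝ, E)⟯ M) (ε : ℝ) (x : M) : Set M :=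
  {y | ∀ n : ℤ, 0 ≤ n → edist (iter f n x) (iter f n y) ≤ ENNReal.ofReal ε}

/-- The `ε`-unstable set `W^u_ε(x)`. -/
def unstableSet (f : M ≃ₘ^1⟮𝓘(ℝ, E), 𝓘(ℝ, E)⟯ M) (ε : ℝ) (x : M) : Set M :=
  {y | ∀ n : ℤ, n ≤ 0 → edist (iter f n x) (iter f n y) ≤ ENNReal.ofReal ε}

/-- `W^s_ε(x) ∩ W^u_ε(y)` consists of exactly one point whenever `dist(x, y) < δ`. -/
def UniqueIntersection (f : M ≃ₘ^1⟮𝓘(ℝ, E), 𝓘(ℝ, E)⟯ M) (ε δ : ℝ) : Prop :=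
  ∀ x y : M, edist x y < ENNReal.ofReal δ →
    ∃ z : M, stableSet f ε x ∩ unstableSet f ε y = {z}

/-- The bracket `[·,·] : {(x, y) ∈ M² : dist(x, y) < δ} → M`, sending `(x, y)` to the single point
of `W^s_ε(x) ∩ W^u_ε(y)`. -/
def bracket (f : M ≃ₘ^1⟮𝓘(ℝ, E), 𝓘(ℝ, E)⟯ M) (ε δ : ℝ) (h : UniqueIntersection f ε δ) :
    {p : M × M // edist p.1 p.2 < ENNReal.ofReal δ} → M :=
  fun p => (h p.1.1 p.1.2 p.2).choose

/-- The defining property of the bracket. -/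
theorem bracket_spec (f : M ≃ₘ^1⟮𝓘(ℝ, E), 𝓘(ℝ, E)⟯ M) (ε δ : ℝ) (h : UniqueIntersection f ε δ)
    (p : {p : M × M // edist p.1 p.2 < ENNReal.ofReal δ}) :
    stableSet f ε p.1.1 ∩ unstableSet f ε p.1.2 = {bracket f ε δ h p} :=
  (h p.1.1 p.1.2 p.2).choose_spec

end Metric

end AnosovBracket

end

/-! Uniqueness is expansivity: two points of the intersection stay within `2ε ≤ ρ` of each other
under all iterates. Continuity is a closed-graph argument: the relation "`z` lies in the
intersection for `(x, y)`" is closed and `M` is compact.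

Existence is shadowing. If `x` is close to `y`, the backward orbit of `y` followed by the forward
orbit of `x` is a pseudo-orbit with one small jump, and the time-zero point of an orbit shadowing it
lies in both sets.

Shadowing (`exists_shadow`) is proved for `g = f ^ N`, with `N` so large that the contraction beats
the distortion of a finite family of charts; this replaces an adapted metric. In charts, an orbit
near the pseudo-orbit `x n` is a small sequence with `v (n + 1) = G n (v n)`, where `G n` is close
to a linear map `A n` contracting the stable and expanding the unstable directions. Solving for
stable components forwards and unstable ones backwards makes this a fixed point problem for a
contraction (`exists_bounded_orbit`). The splittings at `g (x n)` and `x (n + 1)` differ slightly;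
continuity of the subspaces makes the discrepancy `κ` harmless. -/

namespace AnosovBracket

open scoped Uniformity

/-! ### Contraction principle for bounded sequences -/

section Banach

open Metric

variable {E : Type*} [NormedAddCommGroup E]

/-- A uniformly contracting family of maps `Φ n`, which depend on the terms of index `n - 1`, `n`
and `n + 1` of a sequence, has a bounded fixed sequence. -/
theorem exists_fixed_sequence [CompleteSpace E] {R α : ℝ} (hR : 0 ≤ R) (Φ : (ℤ → E) → ℤ → E)
    (hΦ : ∀ v w : ℤ → E, (∀ n, ‖v n‖ ≤ R) → (∀ n, ‖w n‖ ≤ R) → ∀ d : ℝ,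
      (∀ n, ‖v n - w n‖ ≤ d) → ∀ n, ‖Φ v n - Φ w n‖ ≤ 1 / 2 * d)
    (h0 : ∀ n, ‖Φ 0 n‖ ≤ α) (hα : α ≤ R / 2) :
    ∃ v : ℤ → E, (∀ n, ‖v n‖ ≤ R) ∧ Φ v = v := by
  -- The contraction moves `Φ v` at most `R / 2` from `Φ 0`, which itself has size at most `R / 2`.
  have hmaps : ∀ v : ℤ → E, (∀ n, ‖v n‖ ≤ R) → ∀ n, ‖Φ v n‖ ≤ R := by
    intro v hv n
    have h1 := hΦ v 0 hv (by simpa using hR) R (by simpa using hv) n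
    have h2 := h0 n
    have h3 : ‖Φ v n‖ ≤ ‖Φ v n - Φ 0 n‖ + ‖Φ 0 n‖ := by
      simpa using norm_add_le (Φ v n - Φ 0 n) (Φ 0 n)
    linarith
  let s : Set (BoundedContinuousFunction ℤ E) := closedBall 0 R
  have hs : ∀ v ∈ s, ∀ n, ‖v n‖ ≤ R := fun v hv n =>
    (v.norm_coe_le_norm n).trans (by simpa [s] using hv)
  let T : s → s := fun v =>
    ⟨BoundedContinuousFunction.ofNormedAddCommGroupDiscrete (Φ v.1) R (hmaps _ (hs _ v.2)), by
      simp only [s, mem_closedBall, dist_zero_right]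
      exact BoundedContinuousFunction.norm_ofNormedAddCommGroup_le _ hR (hmaps _ (hs _ v.2))⟩
  have hT : ContractingWith (1 / 2) T := by
    refine ⟨by norm_num, LipschitzWith.of_dist_le_mul fun v w => ?_⟩
    rw [Subtype.dist_eq, Subtype.dist_eq, BoundedContinuousFunction.dist_le (by positivity)]
    intro n
    rw [dist_eq_norm]
    refine hΦ v.1 w.1 (hs _ v.2) (hs _ w.2) _ (fun m => ?_) n
    rw [← dist_eq_norm]
    exact BoundedContinuousFunction.dist_coe_le_dist m
  have : CompleteSpace s := isClosed_closedBall.completeSpace_coe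
  have : Nonempty s := ⟨⟨0, by simpa [s] using hR⟩⟩
  have hfix := hT.fixedPoint_isFixedPt
  refine ⟨(hT.fixedPoint T).1, hs _ (hT.fixedPoint T).2, ?_⟩
  have := congrArg (fun v : s => (v.1 : ℤ → E)) hfix
  exact this

/-- Analytic form of the shadowing lemma: a sequence of maps close to a hyperbolic sequence of
linear maps has a bounded orbit. -/
theorem exists_bounded_orbit [NormedSpace ℝ E] [CompleteSpace E] (A B P P' : ℤ → E →L[ℝ] E) (G : ℤ → E → E)
    {θ κ a C η α R : ℝ} (hR : 0 ≤ R) (hC : 0 ≤ C) (hθ : 0 ≤ θ) (hη : 0 ≤ η)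
    (hP : ∀ n v, P n (P n v) = P n v)
    (hPA : ∀ n v, P' n (A n v) = A n (P n v))
    (hAP : ∀ n v, ‖A n (P n v)‖ ≤ θ * ‖v‖) (hB : ∀ n v, ‖B n v‖ ≤ θ * ‖v‖)
    (hAB : ∀ n v, A n (B n v) = v - P' n v) (hPB : ∀ n v, P n (B n v) = 0)
    (hPC : ∀ n v, ‖P n v‖ ≤ C * ‖v‖) (hPP' : ∀ n v, ‖P (n + 1) v - P' n v‖ ≤ κ * ‖v‖)
    (hκ : 0 ≤ κ) (hκ1 : κ < 1) (ha : 0 ≤ a) (hA : ∀ n v, ‖A n v‖ ≤ a * ‖v‖)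
    (hG : ∀ n v w, ‖v‖ ≤ R → ‖w‖ ≤ R → ‖G n v - G n w - A n (v - w)‖ ≤ η * ‖v - w‖)
    (hG0 : ∀ n, ‖G n 0‖ ≤ α)
    (h1 : (θ + κ * a + C * η) + θ * (1 + η) ≤ 1 / 2) (h2 : C * α + θ * α ≤ R / 2) :
    ∃ v : ℤ → E, (∀ n, ‖v n‖ ≤ R) ∧ ∀ n, v (n + 1) = G n (v n) := by
  -- `P n` projects to the stable space and `B n` inverts `A n` on the unstable one. The first
  -- summand takes the stable part from time `n - 1`; the second solves `v (n + 1) = A n (v n) + (G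
  -- n - A n) (v n)` backwards for the unstable part.
  refine Exists.imp ?_ (exists_fixed_sequence hR
    (fun v n => P n (G (n - 1) (v (n - 1))) + B n (v (n + 1) - G n (v n) + A n (v n)))
    (α := C * α + θ * α) ?_ ?_ h2)
  · rintro v ⟨hv, hfix⟩
    refine ⟨hv, fun n => ?_⟩
    have key : ∀ n, P n (v n) = P n (G (n - 1) (v (n - 1))) := by
      intro n
      have := congrArg (P n) (congrFun hfix n)
      simp only [map_add, hP, hPB, add_zero] at this
      exact this.symm
    have hw1 : P (n + 1) (v (n + 1) - G n (v n)) = 0 := by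
      have := key (n + 1)
      rw [add_sub_cancel_right] at this
      rw [map_sub, this, sub_self]
    -- Applying `A n` to the fixed point equation cancels the stable part, so the defect has only a
    -- `P' n` component. As `P (n + 1)` kills it and the two projections differ by `κ < 1`, it
    -- vanishes.
    have hw2 : v (n + 1) - G n (v n) = P' n (v (n + 1) - G n (v n)) := by
      have h := congrArg (A n) (congrFun hfix n)
      simp only [map_add (A n), hAB] at h
      rw [← key n, ← hPA, map_add (P' n)] at h
      have h' : v (n + 1) - G n (v n) - P' n (v (n + 1) - G n (v n)) = 0 := by
        rw [← sub_eq_zero] at h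
        rw [← h]; abel
      exact sub_eq_zero.1 h'
    have h := hPP' n (v (n + 1) - G n (v n))
    rw [hw1, zero_sub, norm_neg, ← hw2] at h
    have : ‖v (n + 1) - G n (v n)‖ = 0 := by
      have := norm_nonneg (v (n + 1) - G n (v n))
      nlinarith
    exact sub_eq_zero.1 (norm_eq_zero.1 this)
  · intro v w hv hw d hd n
    have hd0 : 0 ≤ d := (norm_nonneg _).trans (hd 0)
    set e := fun m => G m (v m) - G m (w m) - A m (v m - w m) with he
    have hee : ∀ m, ‖e m‖ ≤ η * d := fun m =>
      (hG m _ _ (hv m) (hw m)).trans (by gcongr; exact hd m)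
    have hAd : ∀ m, ‖A m (v m - w m)‖ ≤ a * d := fun m =>
      (hA m _).trans (by gcongr; exact hd m)
    -- The four terms are the mismatch of projections, the stable contraction, the nonlinear error,
    -- and the unstable part solved backwards.
    have hdecomp : ∀ n, P n (G (n - 1) (v (n - 1))) + B n (v (n + 1) - G n (v n) + A n (v n)) -
        (P n (G (n - 1) (w (n - 1))) + B n (w (n + 1) - G n (w n) + A n (w n))) =
        (P n (A (n - 1) (v (n - 1) - w (n - 1))) - P' (n - 1) (A (n - 1) (v (n - 1) - w (n - 1)))) +
        A (n - 1) (P (n - 1) (v (n - 1) - w (n - 1))) + P n (e (n - 1)) +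
        B n ((v (n + 1) - w (n + 1)) - e n) := by
      intro n
      rw [← hPA]
      simp only [he, map_sub, map_add]
      abel
    simp only [hdecomp]
    calc _ ≤ κ * (a * d) + θ * d + C * (η * d) + θ * (d + η * d) := by
          refine (norm_add_le _ _).trans (add_le_add ((norm_add_le _ _).trans (add_le_add
            ((norm_add_le _ _).trans (add_le_add ?_ ?_)) ?_)) ?_)
          · have h := hPP' (n - 1) (A (n - 1) (v (n - 1) - w (n - 1)))
            rw [sub_add_cancel] at h
            exact h.trans (by gcongr; exact hAd _)
          · exact (hAP _ _).trans (by gcongr; exact hd _)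
          · exact (hPC _ _).trans (by gcongr; exact hee _)
          · refine (hB _ _).trans ?_
            gcongr
            exact (norm_sub_le _ _).trans (add_le_add (hd _) (hee _))
      _ = ((θ + κ * a + C * η) + θ * (1 + η)) * d := by ring
      _ ≤ 1 / 2 * d := by gcongr
  · intro n
    simp only [Pi.zero_apply, map_zero, add_zero, zero_sub]
    refine (norm_add_le _ _).trans (add_le_add ?_ ?_)
    · exact (hPC _ _).trans (by gcongr; exact hG0 _)
    · refine (hB _ _).trans ?_
      rw [norm_neg]
      gcongr
      exact hG0 _

end Banach

/-! ### Tangent vectors in charts and continuity of the splitting -/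

section TangentCoord

variable {E : Type*} [NormedAddCommGroup E] [NormedSpace ℝ E]
  {M : Type*} [TopologicalSpace M] [ChartedSpace E M] [IsManifold 𝓘(ℝ, E) 1 M]

/-- The coordinates of tangent vectors at `x` in the chart at `p`. -/
noncomputable def tangentCoord (p x : M) : TangentSpace 𝓘(ℝ, E) x →L[ℝ] E :=
  (trivializationAt E (TangentSpace 𝓘(ℝ, E)) p).continuousLinearMapAt ℝ x

/-- The inverse of `tangentCoord`. -/
noncomputable def tangentCoordSymm (p x : M) : E →L[ℝ] TangentSpace 𝓘(ℝ, E) x :=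
  (trivializationAt E (TangentSpace 𝓘(ℝ, E)) p).symmL ℝ x

theorem tangentCoordSymm_tangentCoord {p x : M} (hx : x ∈ (chartAt E p).source)
    (v : TangentSpace 𝓘(ℝ, E) x) : tangentCoordSymm p x (tangentCoord p x v) = v :=
  (trivializationAt E (TangentSpace 𝓘(ℝ, E)) p).symmL_continuousLinearMapAt (R := ℝ) hx v

theorem tangentCoord_tangentCoordSymm {p x : M} (hx : x ∈ (chartAt E p).source) (v : E) :
    tangentCoord p x (tangentCoordSymm p x v) = v :=
  (trivializationAt E (TangentSpace 𝓘(ℝ, E)) p).continuousLinearMapAt_symmL (R := ℝ) hx v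

theorem continuousAt_tangentCoord {p x₀ : M} (hx : x₀ ∈ (chartAt E p).source)
    {v : ∀ x : M, TangentSpace 𝓘(ℝ, E) x}
    (hv : ContinuousAt (fun x => (⟨x, v x⟩ : TangentBundle 𝓘(ℝ, E) M)) x₀) :
    ContinuousAt (fun x => tangentCoord p x (v x)) x₀ := by
  set e := trivializationAt E (TangentSpace 𝓘(ℝ, E)) p with he
  have h1 : ContinuousAt e (⟨x₀, v x₀⟩ : TangentBundle 𝓘(ℝ, E) M) :=
    e.continuousOn.continuousAt (e.open_source.mem_nhds (e.mem_source.2 hx))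
  have h2 : ContinuousAt (fun x => (e (⟨x, v x⟩ : TangentBundle 𝓘(ℝ, E) M)).2) x₀ :=
    continuousAt_snd.comp (ContinuousAt.comp (x := x₀) h1 hv)
  refine h2.congr ?_
  filter_upwards [(chartAt E p).open_source.mem_nhds hx] with x hx'
  rw [tangentCoord, Trivialization.continuousLinearMapAt_apply,
    Trivialization.coe_linearMapAt_of_mem _ hx']

variable [FiniteDimensional ℝ E]

/-- The projection of `T_x M` on `S x` along `U x`, in the coordinates of the chart at `p`. -/
noncomputable def splitProj {S U : ∀ x : M, Submodule ℝ (TangentSpace 𝓘(ℝ, E) x)}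
    (h : ∀ x, IsCompl (S x) (U x)) (p x : M) : E →L[ℝ] E :=
  LinearMap.toContinuousLinearMap
    ((tangentCoord p x).toLinearMap ∘ₗ (Submodule.projection (S x) (U x) (h x)) ∘ₗ (tangentCoordSymm p x).toLinearMap)

theorem splitProj_apply {S U : ∀ x : M, Submodule ℝ (TangentSpace 𝓘(ℝ, E) x)}
    (h : ∀ x, IsCompl (S x) (U x)) (p x : M) (v : E) :
    splitProj h p x v = tangentCoord p x ((Submodule.projection (S x) (U x) (h x)) (tangentCoordSymm p x v)) := rfl

theorem splitProj_tangentCoord {S U : ∀ x : M, Submodule ℝ (TangentSpace 𝓘(ℝ, E) x)}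
    (h : ∀ x, IsCompl (S x) (U x)) {p x : M} (hx : x ∈ (chartAt E p).source)
    (v : TangentSpace 𝓘(ℝ, E) x) :
    splitProj h p x (tangentCoord p x v) = tangentCoord p x ((Submodule.projection (S x) (U x) (h x)) v) := by
  rw [splitProj_apply, tangentCoordSymm_tangentCoord hx]

/-- The map sending coefficients to the linear combination of a family of vectors. -/
noncomputable def combination {ι : Type*} [Fintype ι] (w : ι → E) : (ι → ℝ) →L[ℝ] E :=
  ∑ i, (ContinuousLinearMap.proj (R := ℝ) (φ := fun _ : ι => ℝ) i).smulRight (w i)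

omit [FiniteDimensional ℝ E] in
theorem combination_apply {ι : Type*} [Fintype ι] (w : ι → E) (c : ι → ℝ) :
    combination w c = ∑ i, c i • w i := by
  simp [combination]

/-- Local frames of `S` and `U` together form a basis. In it the projection is the constant matrix
`pr`, so in coordinates it is `pr` conjugated by the frame map, which varies continuously together
with its inverse. -/
theorem continuousAt_splitProj {S U : ∀ x : M, Submodule ℝ (TangentSpace 𝓘(ℝ, E) x)}
    (hS : IsContinuousSubspaceField S) (hU : IsContinuousSubspaceField U)
    (h : ∀ x, IsCompl (S x) (U x)) {p x₀ : M} (hx : x₀ ∈ (chartAt E p).source) :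
    ContinuousAt (splitProj h p) x₀ := by
  obtain ⟨V, hV, k, v, hv, hvS⟩ := hS x₀
  obtain ⟨W, hW, l, u, hu, huU⟩ := hU x₀
  let w : M → (Fin k ⊕ Fin l) → E := fun x =>
    Sum.elim (fun i => tangentCoord p x (v i x)) (fun i => tangentCoord p x (u i x))
  have hw : ∀ i, ContinuousAt (fun x => w x i) x₀ := by
    rintro (i | i)
    · exact continuousAt_tangentCoord hx ((hv i).continuousAt hV)
    · exact continuousAt_tangentCoord hx ((hu i).continuousAt hW)
  have hL : ContinuousAt (fun x => combination (w x)) x₀ := by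
    unfold combination
    refine tendsto_finsetSum _ fun i _ => ?_
    exact ((ContinuousLinearMap.smulRightL ℝ (Fin k ⊕ Fin l → ℝ) E
      (ContinuousLinearMap.proj i)).continuous.continuousAt).comp (hw i)
  let pr : (Fin k ⊕ Fin l → ℝ) →L[ℝ] (Fin k ⊕ Fin l → ℝ) :=
    ContinuousLinearMap.pi fun i => Sum.elim (fun j => ContinuousLinearMap.proj (Sum.inl j))
      (fun _ => 0) i
  have hinv : ∀ x ∈ V ∩ W ∩ (chartAt E p).source, (combination (w x)).IsInvertible ∧
      splitProj h p x = combination (w x) ∘L pr ∘L (combination (w x)).inverse := by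
    rintro x ⟨⟨hxV, hxW⟩, hxp⟩
    let e : TangentSpace 𝓘(ℝ, E) x ≃ₗ[ℝ] E :=
      LinearEquiv.ofLinearMap (tangentCoord p x).toLinearMap (tangentCoordSymm p x).toLinearMap
        (LinearMap.ext fun y => tangentCoord_tangentCoordSymm hxp y)
        (LinearMap.ext fun y => tangentCoordSymm_tangentCoord hxp y)
    have hli : LinearIndependent ℝ (Sum.elim (fun i => v i x) (fun i => u i x)) :=
      (hvS x hxV).1.sum_type (huU x hxW).1 (by
        rw [(hvS x hxV).2, (huU x hxW).2]; exact (h x).disjoint)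
    have hsp : ⊤ ≤ Submodule.span ℝ (range (Sum.elim (fun i => v i x) (fun i => u i x))) := by
      rw [Sum.elim_range, Submodule.span_union, (hvS x hxV).2, (huU x hxW).2, (h x).sup_eq_top]
    let b := ((Module.Basis.mk hli hsp).map e)
    let L : (Fin k ⊕ Fin l → ℝ) ≃L[ℝ] E := b.equivFun.symm.toContinuousLinearEquiv
    have hLw : (L : (Fin k ⊕ Fin l → ℝ) →L[ℝ] E) = combination (w x) := by
      ext1 c
      rw [combination_apply]
      change b.equivFun.symm c = _
      rw [Module.Basis.equivFun_symm_apply]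
      refine Finset.sum_congr rfl fun i _ => ?_
      congr 1
      rcases i with i | i <;> simp [b, w, e]
    refine ⟨⟨L, hLw⟩, ?_⟩
    have hcomm : ∀ c, splitProj h p x (combination (w x) c) = combination (w x) (pr c) := by
      intro c
      rw [combination_apply, combination_apply, map_sum]
      refine Finset.sum_congr rfl fun i _ => ?_
      rcases i with i | i
      · have hm : v i x ∈ S x := by
          rw [← (hvS x hxV).2]; exact Submodule.subset_span ⟨i, rfl⟩
        simp [w, pr, splitProj_tangentCoord h hxp,
          Submodule.projection_apply_of_mem_left (h x) hm]
      · have hm : u i x ∈ U x := by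
          rw [← (huU x hxW).2]; exact Submodule.subset_span ⟨i, rfl⟩
        have hz := (Submodule.projection_apply_eq_zero_iff (h x)).2 hm
        simp [w, pr, splitProj_tangentCoord h hxp, hz]
    ext1 y
    rw [← hLw, ContinuousLinearMap.inverse_equiv]
    have := hcomm (L.symm y)
    rw [← hLw] at this
    simpa using this
  have hnhds : V ∩ W ∩ (chartAt E p).source ∈ 𝓝 x₀ :=
    inter_mem (inter_mem hV hW) ((chartAt E p).open_source.mem_nhds hx)
  have hI : ContinuousAt (fun x => (combination (w x)).inverse) x₀ := by
    have := ((hinv x₀ (mem_of_mem_nhds hnhds)).1.contDiffAt_map_inverse (n := 0)).continuousAt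
    exact ContinuousAt.comp (f := fun x => combination (w x)) this hL
  refine (hL.clm_comp (continuousAt_const.clm_comp hI) : ContinuousAt
    (fun x => combination (w x) ∘L pr ∘L (combination (w x)).inverse) x₀).congr ?_
  filter_upwards [hnhds] with x hx
  exact (hinv x hx).2.symm

end TangentCoord

/-! ### Uniform estimates near compact sets -/

section Uniform

variable {E : Type*} [NormedAddCommGroup E] [NormedSpace ℝ E]

/-- A `C^1` map is uniformly close to its derivatives near a compact set. -/
theorem exists_uniform_linear_approx {F : E → E} {O K : Set E} (hO : IsOpen O) (hK : IsCompact K)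
    (hKO : K ⊆ O) (hF : ∀ u ∈ O, ContDiffAt ℝ 1 F u) {η : ℝ} (hη : 0 < η) :
    ∃ r : ℝ, 0 < r ∧ ∀ u ∈ K, ∀ v : E, ‖v‖ ≤ r → u + v ∈ O ∧ ∀ w : E, ‖w‖ ≤ r →
      ‖F (u + v) - F (u + w) - fderiv ℝ F u (v - w)‖ ≤ η * ‖v - w‖ := by
  obtain ⟨r₁, hr₁, hr₁O⟩ := hK.exists_cthickening_subset_open hO hKO
  have hcont : ∀ u ∈ K, ContinuousAt (fderiv ℝ F) u := fun u hu =>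
    ((hF u (hKO hu)).fderiv_right (m := 0) (by norm_num)).continuousAt
  have hunif := hK.uniformContinuousAt_of_continuousAt (fderiv ℝ F) hcont
    (Metric.dist_mem_uniformity hη)
  obtain ⟨r₂, hr₂, h₂⟩ := Metric.mem_uniformity_dist.1 hunif
  have hball : ∀ u ∈ K, ∀ z ∈ Metric.closedBall u (min r₁ (r₂ / 2)), z ∈ O := fun u hu z hz =>
    hr₁O (Metric.mem_cthickening_of_dist_le z u r₁ K hu
      ((Metric.mem_closedBall.1 hz).trans (min_le_left _ _)))
  -- `r₁` keeps the balls inside `O`; on them the derivative varies by less than `η`, so the mean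
  -- value inequality applies. Halving `r₂` gives strict inequality on closed balls.
  refine ⟨min r₁ (r₂ / 2), by positivity, fun u hu v hv => ?_⟩
  have hmem : ∀ v : E, ‖v‖ ≤ min r₁ (r₂ / 2) →
      u + v ∈ Metric.closedBall u (min r₁ (r₂ / 2)) := fun v hv => by
    simpa [dist_eq_norm] using hv
  refine ⟨hball u hu _ (hmem v hv), fun w hw => ?_⟩
  have := (convex_closedBall u (min r₁ (r₂ / 2))).norm_image_sub_le_of_norm_fderiv_le'
    (f := F) (φ := fderiv ℝ F u) (C := η)
    (fun z hz => (hF z (hball u hu z hz)).differentiableAt (by norm_num))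
    (fun z hz => ?_) (hmem w hw) (hmem v hv)
  · simpa using this
  · have hz' : dist u z < r₂ := by
      rw [dist_comm]
      have := (Metric.mem_closedBall.1 hz).trans (min_le_right _ _)
      linarith
    have := h₂ hz' hu
    simp only [mem_ofPred_eq, dist_eq_norm] at this
    rw [norm_sub_rev]
    exact this.le

/-- A choice of small radii for finitely many conditions. -/
theorem exists_pos_forall_finset {ι : Type*} (s : Finset ι) (Q : ι → ℝ → Prop)
    (hmono : ∀ i r r', r ≤ r' → Q i r' → Q i r) (h : ∀ i ∈ s, ∃ r : ℝ, 0 < r ∧ Q i r) :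
    ∃ r : ℝ, 0 < r ∧ ∀ i ∈ s, Q i r := by
  have : ∀ᶠ r : ℝ in 𝓝[>] 0, ∀ i ∈ s, Q i r := by
    rw [Filter.eventually_all_finset]
    intro i hi
    obtain ⟨r, hr, hQ⟩ := h i hi
    filter_upwards [Ioc_mem_nhdsGT hr] with r' hr'
    exact hmono i _ _ hr'.2 hQ
  obtain ⟨r, hr, hr'⟩ := (this.and self_mem_nhdsWithin).exists
  exact ⟨r, hr', hr⟩

end Uniform

/-! ### Maps and their derivatives in charts -/

section CoordDeriv

variable {E : Type*} [NormedAddCommGroup E] [NormedSpace ℝ E]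
  {M : Type*} [TopologicalSpace M] [ChartedSpace E M]

/-- The map `g` read in the charts at `p` and `q`. -/
noncomputable def chartMap (g : M → M) (p q : M) : E → E :=
  fun v => chartAt E q (g ((chartAt E p).symm v))

/-- The set where `chartMap` is meaningful. -/
def chartDomain (E : Type*) [NormedAddCommGroup E] [NormedSpace ℝ E] [ChartedSpace E M]
    (g : M → M) (p q : M) : Set E :=
  (chartAt E p).target ∩ (chartAt E p).symm ⁻¹' (g ⁻¹' (chartAt E q).source)

theorem isOpen_chartDomain {g : M → M} (hg : Continuous g) (p q : M) :
    IsOpen (chartDomain E g p q) :=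
  (chartAt E p).isOpen_inter_preimage_symm ((chartAt E q).open_source.preimage hg)

theorem chartAt_mem_chartDomain {g : M → M} {p q x : M} (hx : x ∈ (chartAt E p).source)
    (hgx : g x ∈ (chartAt E q).source) : chartAt E p x ∈ chartDomain E g p q := by
  refine ⟨(chartAt E p).map_source hx, ?_⟩
  simpa [(chartAt E p).left_inv hx] using hgx

variable [IsManifold 𝓘(ℝ, E) 1 M]

theorem contDiffAt_chartMap {g : M → M} (hg : ContMDiff 𝓘(ℝ, E) 𝓘(ℝ, E) 1 g) {p q : M} {u : E}
    (hu : u ∈ chartDomain E g p q) : ContDiffAt ℝ 1 (chartMap g p q) u := by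
  rw [← contMDiffAt_iff_contDiffAt]
  have h1 : ContMDiffAt 𝓘(ℝ, E) 𝓘(ℝ, E) 1 (chartAt E p).symm u :=
    (contMDiffOn_chart_symm (I := 𝓘(ℝ, E))).contMDiffAt ((chartAt E p).open_target.mem_nhds hu.1)
  have h2 : ContMDiffAt 𝓘(ℝ, E) 𝓘(ℝ, E) 1 (chartAt E q) (g ((chartAt E p).symm u)) :=
    (contMDiffOn_chart (I := 𝓘(ℝ, E))).contMDiffAt ((chartAt E q).open_source.mem_nhds hu.2)
  exact ContMDiffAt.comp u h2 (ContMDiffAt.comp u (hg.contMDiffAt) h1)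

/-- The derivative of `g` at `x`, read in the coordinates of the charts at `p` and `q`. -/
noncomputable def coordDeriv (g : M → M) (p q x : M) : E →L[ℝ] E :=
  tangentCoord q (g x) ∘L mfderiv 𝓘(ℝ, E) 𝓘(ℝ, E) g x ∘L tangentCoordSymm p x

theorem coordDeriv_apply (g : M → M) (p q x : M) (v : E) : coordDeriv g p q x v =
    tangentCoord q (g x) (mfderiv 𝓘(ℝ, E) 𝓘(ℝ, E) g x (tangentCoordSymm p x v)) := rfl

theorem coordDeriv_tangentCoord (g : M → M) {p q x : M} (hx : x ∈ (chartAt E p).source)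
    (v : TangentSpace 𝓘(ℝ, E) x) : coordDeriv g p q x (tangentCoord p x v) =
    tangentCoord q (g x) (mfderiv 𝓘(ℝ, E) 𝓘(ℝ, E) g x v) := by
  rw [coordDeriv_apply, tangentCoordSymm_tangentCoord hx]

theorem coordDeriv_coordDeriv {g h : M → M} (hg : MDifferentiable 𝓘(ℝ, E) 𝓘(ℝ, E) g)
    (hh : MDifferentiable 𝓘(ℝ, E) 𝓘(ℝ, E) h) {p q r x : M} (hx : h x ∈ (chartAt E q).source)
    (v : E) : coordDeriv g q r (h x) (coordDeriv h p q x v) = coordDeriv (g ∘ h) p r x v := by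
  rw [coordDeriv_apply h, coordDeriv_tangentCoord g hx, coordDeriv_apply,
    mfderiv_comp x (hg _) (hh _)]
  rfl

theorem coordDeriv_id {p x : M} (hx : x ∈ (chartAt E p).source) (v : E) :
    coordDeriv id p p x v = v := by
  rw [coordDeriv_apply, mfderiv_id]
  exact tangentCoord_tangentCoordSymm hx v

theorem mfderiv_chartAt {p x : M} (hx : x ∈ (chartAt E p).source) :
    mfderiv 𝓘(ℝ, E) 𝓘(ℝ, E) (chartAt E p) x = tangentCoord p x :=
  (TangentBundle.continuousLinearMapAt_trivializationAt (𝕜 := ℝ) (I := 𝓘(ℝ, E)) hx).symm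

theorem mfderiv_chartAt_symm {p : M} {u : E} (hu : u ∈ (chartAt E p).target) :
    mfderiv 𝓘(ℝ, E) 𝓘(ℝ, E) (chartAt E p).symm u =
      tangentCoordSymm (E := E) p ((chartAt E p).symm u) := by
  have hx := (chartAt E p).map_target hu
  have h := (mdifferentiable_chart (I := 𝓘(ℝ, E)) p).comp_symm_deriv hu
  rw [mfderiv_chartAt hx] at h
  ext1 w
  have hw : tangentCoord p ((chartAt E p).symm u)
      (mfderiv 𝓘(ℝ, E) 𝓘(ℝ, E) (chartAt E p).symm u w) = w := DFunLike.congr_fun h w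
  exact (tangentCoordSymm_tangentCoord hx _).symm.trans (congrArg (tangentCoordSymm (E := E) p _) hw)

/-- Links calculus in `E` with the tangent map, on which the hyperbolicity hypotheses are stated. -/
theorem fderiv_chartMap {g : M → M} (hg : MDifferentiable 𝓘(ℝ, E) 𝓘(ℝ, E) g) {p q x : M}
    (hx : x ∈ (chartAt E p).source) (hgx : g x ∈ (chartAt E q).source) :
    fderiv ℝ (chartMap g p q) (chartAt E p x) = coordDeriv g p q x := by
  obtain ⟨u, hu, rfl⟩ : ∃ u ∈ (chartAt E p).target, (chartAt E p).symm u = x :=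
    ⟨_, (chartAt E p).map_source hx, (chartAt E p).left_inv hx⟩
  rw [(chartAt E p).right_inv hu]
  have h1 := (mdifferentiableAt_atlas_symm (I := 𝓘(ℝ, E)) (chart_mem_atlas E p) hu).hasMFDerivAt
  rw [mfderiv_chartAt_symm hu] at h1
  have h2 := (mdifferentiableAt_atlas (I := 𝓘(ℝ, E)) (chart_mem_atlas E q) hgx).hasMFDerivAt
  rw [mfderiv_chartAt hgx] at h2
  have h3 := h2.comp u ((hg _).hasMFDerivAt.comp u h1)
  have h4 : HasFDerivAt (chartMap g p q) (coordDeriv g p q ((chartAt E p).symm u)) u :=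
    h3.hasFDerivAt
  exact h4.fderiv

end CoordDeriv

/-! ### Iterates -/

section Iter

variable {E : Type*} [NormedAddCommGroup E] [NormedSpace ℝ E]
  {M : Type*} [TopologicalSpace M] [ChartedSpace E M]

theorem iter_zero (f : M ≃ₘ^1⟮𝓘(ℝ, E), 𝓘(ℝ, E)⟯ M) : iter f 0 = id := rfl

theorem iter_one (f : M ≃ₘ^1⟮𝓘(ℝ, E), 𝓘(ℝ, E)⟯ M) : iter f 1 = f := by
  simp only [iter, zpow_one]
  rfl

theorem iter_neg_one (f : M ≃ₘ^1⟮𝓘(ℝ, E), 𝓘(ℝ, E)⟯ M) : iter f (-1) = f.symm := by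
  simp only [iter, zpow_neg_one]
  rfl

theorem iter_add (f : M ≃ₘ^1⟮𝓘(ℝ, E), 𝓘(ℝ, E)⟯ M) (m n : ℤ) :
    iter f (m + n) = iter f m ∘ iter f n := by
  simp only [iter, zpow_add]
  rfl

theorem iter_add_apply (f : M ≃ₘ^1⟮𝓘(ℝ, E), 𝓘(ℝ, E)⟯ M) (m n : ℤ) (x : M) :
    iter f (m + n) x = iter f m (iter f n x) := by
  rw [iter_add, Function.comp_apply]

theorem iter_neg_iter (f : M ≃ₘ^1⟮𝓘(ℝ, E), 𝓘(ℝ, E)⟯ M) (n : ℤ) (x : M) :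
    iter f (-n) (iter f n x) = x := by
  rw [← iter_add_apply, neg_add_cancel, iter_zero, id]

theorem iter_iter_neg (f : M ≃ₘ^1⟮𝓘(ℝ, E), 𝓘(ℝ, E)⟯ M) (n : ℤ) (x : M) :
    iter f n (iter f (-n) x) = x := by
  rw [← iter_add_apply, add_neg_cancel, iter_zero, id]

theorem contMDiff_iter (f : M ≃ₘ^1⟮𝓘(ℝ, E), 𝓘(ℝ, E)⟯ M) (n : ℤ) :
    ContMDiff 𝓘(ℝ, E) 𝓘(ℝ, E) 1 (iter f n) := by
  induction n with
  | zero => exact contMDiff_id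
  | succ n ih => rw [iter_add, iter_one]; exact ih.comp f.contMDiff
  | pred n ih => rw [sub_eq_add_neg, iter_add, iter_neg_one]; exact ih.comp f.symm.contMDiff

theorem eq_iter_of_succ (f : M ≃ₘ^1⟮𝓘(ℝ, E), 𝓘(ℝ, E)⟯ M) (N : ℤ) {z : ℤ → M}
    (hz : ∀ n, z (n + 1) = iter f N (z n)) (n : ℤ) : z n = iter f (N * n) (z 0) := by
  induction n with
  | zero => rw [mul_zero, iter_zero, id]
  | succ n ih => rw [hz, ih, ← iter_add_apply]; congr 1; ring
  | pred n ih =>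
    have h := hz (-n - 1)
    rw [sub_add_cancel, ih] at h
    rw [← iter_neg_iter f N (z (-n - 1)), ← h, ← iter_add_apply]
    congr 1; ring

theorem map_mfderiv_iter (f : M ≃ₘ^1⟮𝓘(ℝ, E), 𝓘(ℝ, E)⟯ M)
    {S : ∀ x : M, Submodule ℝ (TangentSpace 𝓘(ℝ, E) x)}
    (hS : ∀ x, (S x).map (mfderiv 𝓘(ℝ, E) 𝓘(ℝ, E) f x).toLinearMap = S (f x)) (n : ℕ) :
    ∀ x, (S x).map (mfderiv 𝓘(ℝ, E) 𝓘(ℝ, E) (iter f n) x).toLinearMap = S (iter f n x) := by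
  induction n with
  | zero =>
    intro x
    rw [Nat.cast_zero, iter_zero, mfderiv_id]
    exact Submodule.map_id _
  | succ n ih =>
    have h : iter f ((n + 1 : ℕ) : ℤ) = f ∘ iter f n := by
      rw [← iter_one, ← iter_add]; congr 1; push_cast; ring
    intro x
    rw [h, mfderiv_comp x (f.mdifferentiable one_ne_zero _)
      ((contMDiff_iter f n).mdifferentiable one_ne_zero _)]
    rw [Function.comp_apply, ← hS (iter f n x), ← ih x, ← Submodule.map_comp]
    rfl

end Iter

/-! ### Closed graph, continuity and uniqueness -/

section Bracket

variable {E : Type*} [NormedAddCommGroup E] [NormedSpace ℝ E]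
  {M : Type*} [EMetricSpace M] [ChartedSpace E M]

theorem isClosed_setOf_mem_stableSet_inter_unstableSet (f : M ≃ₘ^1⟮𝓘(ℝ, E), 𝓘(ℝ, E)⟯ M) (ε : ℝ) :
    IsClosed {p : (M × M) × M | p.2 ∈ stableSet f ε p.1.1 ∩ unstableSet f ε p.1.2} := by
  have hc : ∀ n : ℤ, Continuous (iter f n) := fun n => (contMDiff_iter f n).continuous
  have h : {p : (M × M) × M | p.2 ∈ stableSet f ε p.1.1 ∩ unstableSet f ε p.1.2} =
      (⋂ n : ℤ, ⋂ _ : 0 ≤ n, {p : (M × M) × M |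
        edist (iter f n p.1.1) (iter f n p.2) ≤ ENNReal.ofReal ε}) ∩
      (⋂ n : ℤ, ⋂ _ : n ≤ 0, {p : (M × M) × M |
        edist (iter f n p.1.2) (iter f n p.2) ≤ ENNReal.ofReal ε}) := by
    ext p
    simp [stableSet, unstableSet]
  rw [h]
  refine IsClosed.inter ?_ ?_
  · exact isClosed_iInter fun n => isClosed_iInter fun _ => isClosed_le
      (((hc n).comp (by fun_prop)).edist ((hc n).comp (by fun_prop))) continuous_const
  · exact isClosed_iInter fun n => isClosed_iInter fun _ => isClosed_le
      (((hc n).comp (by fun_prop)).edist ((hc n).comp (by fun_prop))) continuous_const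

/-- The preimage of a closed set is the projection along the compact factor `M` of a closed part of
the graph, hence closed. -/
theorem continuous_bracket [CompactSpace M] (f : M ≃ₘ^1⟮𝓘(ℝ, E), 𝓘(ℝ, E)⟯ M) (ε δ : ℝ)
    (h : UniqueIntersection f ε δ) : Continuous (bracket f ε δ h) := by
  rw [continuous_iff_isClosed]
  intro s hs
  have hcl : IsClosed {p : {p : M × M // edist p.1 p.2 < ENNReal.ofReal δ} × M |
      p.2 ∈ stableSet f ε p.1.1.1 ∩ unstableSet f ε p.1.1.2 ∧ p.2 ∈ s} :=
    ((isClosed_setOf_mem_stableSet_inter_unstableSet f ε).preimage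
      (f := fun p : {p : M × M // edist p.1 p.2 < ENNReal.ofReal δ} × M => (p.1.1, p.2))
      (by fun_prop)).inter (hs.preimage continuous_snd)
  convert isClosedMap_fst_of_compactSpace _ hcl using 1
  ext p
  simp only [mem_preimage, mem_image, bracket_spec f ε δ h]
  constructor
  · intro hp
    exact ⟨(p, bracket f ε δ h p), ⟨by simp, hp⟩, rfl⟩
  · rintro ⟨⟨q, z⟩, ⟨hq, hz⟩, rfl⟩
    exact (mem_singleton_iff.1 hq) ▸ hz

theorem eq_of_mem_stableSet_inter_unstableSet {f : M ≃ₘ^1⟮𝓘(ℝ, E), 𝓘(ℝ, E)⟯ M} {ρ ε : ℝ}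
    (hρ : IsExpansivityConstant f ρ) (hε : 0 ≤ ε) (hερ : ε ≤ ρ / 2) {x y z w : M}
    (hz : z ∈ stableSet f ε x ∩ unstableSet f ε y)
    (hw : w ∈ stableSet f ε x ∩ unstableSet f ε y) : z = w := by
  refine (hρ.2 z w).1 fun n => ?_
  have key : ∀ a b c : M, edist a b ≤ ENNReal.ofReal ε → edist a c ≤ ENNReal.ofReal ε →
      edist b c ≤ ENNReal.ofReal ρ := fun a b c hb hc => by
    calc edist b c ≤ edist a b + edist a c := edist_triangle_left _ _ _
      _ ≤ ENNReal.ofReal ε + ENNReal.ofReal ε := add_le_add hb hc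
      _ = ENNReal.ofReal (ε + ε) := (ENNReal.ofReal_add hε hε).symm
      _ ≤ ENNReal.ofReal ρ := ENNReal.ofReal_le_ofReal (by linarith)
  rcases le_total 0 n with hn | hn
  · exact key _ _ _ (hz.1 n hn) (hw.1 n hn)
  · exact key _ _ _ (hz.2 n hn) (hw.2 n hn)

end Bracket

/-! ### Invariance of the splitting in coordinates -/

section Step

variable {E : Type*} [NormedAddCommGroup E] [NormedSpace ℝ E] [FiniteDimensional ℝ E]
  {M : Type*} [TopologicalSpace M] [ChartedSpace E M] [IsManifold 𝓘(ℝ, E) 1 M]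
  {S U : ∀ x : M, Submodule ℝ (TangentSpace 𝓘(ℝ, E) x)}

theorem splitProj_splitProj (h : ∀ x, IsCompl (S x) (U x)) {p x : M}
    (hx : x ∈ (chartAt E p).source) (v : E) :
    splitProj h p x (splitProj h p x v) = splitProj h p x v := by
  rw [splitProj_apply h p x v, splitProj_tangentCoord h hx,
    Submodule.projection_apply_of_mem_left (h x) (Submodule.projection_apply_mem _ _)]

/-- The derivative respects both summands, hence commutes with the projection along one onto the
other. -/
theorem splitProj_coordDeriv (h : ∀ x, IsCompl (S x) (U x)) {g : M → M}
    (hgS : ∀ x, (S x).map (mfderiv 𝓘(ℝ, E) 𝓘(ℝ, E) g x).toLinearMap = S (g x))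
    (hgU : ∀ x, (U x).map (mfderiv 𝓘(ℝ, E) 𝓘(ℝ, E) g x).toLinearMap = U (g x)) {p q x : M}
    (hx : x ∈ (chartAt E p).source) (hgx : g x ∈ (chartAt E q).source) (v : E) :
    splitProj h q (g x) (coordDeriv g p q x v) = coordDeriv g p q x (splitProj h p x v) := by
  obtain ⟨w, rfl⟩ : ∃ w, tangentCoord p x w = v := ⟨_, tangentCoord_tangentCoordSymm hx v⟩
  rw [coordDeriv_tangentCoord g hx, splitProj_tangentCoord h hgx, splitProj_tangentCoord h hx,
    coordDeriv_tangentCoord g hx]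
  congr 1
  have hs : mfderiv 𝓘(ℝ, E) 𝓘(ℝ, E) g x (Submodule.projection (S x) (U x) (h x) w) ∈ S (g x) := by
    rw [← hgS x]
    exact Submodule.mem_map_of_mem (Submodule.projection_apply_mem _ _)
  have hu : mfderiv 𝓘(ℝ, E) 𝓘(ℝ, E) g x
      (w - Submodule.projection (S x) (U x) (h x) w) ∈ U (g x) := by
    rw [← hgU x, ← Submodule.projection_eq_self_sub_projection]
    exact Submodule.mem_map_of_mem (Submodule.projection_apply_mem _ _)
  have hw : mfderiv 𝓘(ℝ, E) 𝓘(ℝ, E) g x w =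
      mfderiv 𝓘(ℝ, E) 𝓘(ℝ, E) g x (Submodule.projection (S x) (U x) (h x) w) +
      mfderiv 𝓘(ℝ, E) 𝓘(ℝ, E) g x (w - Submodule.projection (S x) (U x) (h x) w) := by
    rw [← map_add, add_sub_cancel]
  rw [hw, map_add, Submodule.projection_apply_of_mem_left (h _) hs,
    (Submodule.projection_apply_eq_zero_iff (h _)).2 hu, add_zero]

omit [FiniteDimensional ℝ E] in
theorem coordDeriv_coordDeriv_of_inverse {g h : M → M} (hg : MDifferentiable 𝓘(ℝ, E) 𝓘(ℝ, E) g)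
    (hh : MDifferentiable 𝓘(ℝ, E) 𝓘(ℝ, E) h) (hgh : ∀ x, g (h x) = x) {p q x : M}
    (hx : x ∈ (chartAt E p).source) (hhx : h x ∈ (chartAt E q).source) (v : E) :
    coordDeriv g q p (h x) (coordDeriv h p q x v) = v := by
  rw [coordDeriv_coordDeriv hg hh hhx]
  have : g ∘ h = id := funext hgh
  rw [this, coordDeriv_id hx]

end Step

/-! ### Finite atlas with uniform bounds -/

section Cover

variable {E : Type*} [NormedAddCommGroup E] [NormedSpace ℝ E] [FiniteDimensional ℝ E]
  {M : Type*} [TopologicalSpace M] [ChartedSpace E M] [IsManifold 𝓘(ℝ, E) 1 M]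
  [RiemannianBundle (fun x : M => TangentSpace 𝓘(ℝ, E) x)]
  {S U : ∀ x : M, Submodule ℝ (TangentSpace 𝓘(ℝ, E) x)}

/-- Uniform bounds for the chart at `p` and the splitting at the point `x`. -/
structure ChartBounds (h : ∀ x, IsCompl (S x) (U x)) (C : ℝ) (p x : M) : Prop where
  mem_source : x ∈ (chartAt E p).source
  norm_tangentCoord_le : ∀ v : TangentSpace 𝓘(ℝ, E) x, ‖tangentCoord p x v‖ ≤ C * ‖v‖
  norm_tangentCoordSymm_le : ∀ v : E, ‖tangentCoordSymm p x v‖ ≤ C * ‖v‖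
  norm_splitProj_le : ∀ v : E, ‖splitProj h p x v‖ ≤ C * ‖v‖
  norm_sub_splitProj_le : ∀ v : E, ‖v - splitProj h p x v‖ ≤ C * ‖v‖

theorem ChartBounds.mono {h : ∀ x, IsCompl (S x) (U x)} {C C' : ℝ} {p x : M}
    (hb : ChartBounds h C p x) (hC : C ≤ C') : ChartBounds h C' p x where
  mem_source := hb.mem_source
  norm_tangentCoord_le v := (hb.norm_tangentCoord_le v).trans (by gcongr)
  norm_tangentCoordSymm_le v := (hb.norm_tangentCoordSymm_le v).trans (by gcongr)
  norm_splitProj_le v := (hb.norm_splitProj_le v).trans (by gcongr)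
  norm_sub_splitProj_le v := (hb.norm_sub_splitProj_le v).trans (by gcongr)

/-- The projection and the two coordinate changes each cost a factor `C`. -/
theorem ChartBounds.norm_coordDeriv_splitProj_le {h : ∀ x, IsCompl (S x) (U x)} {C c : ℝ}
    {p q x : M} {g : M → M} (hC : 0 ≤ C) (hc : 0 ≤ c) (hx : ChartBounds h C p x)
    (hgx : ChartBounds h C q (g x))
    (hg : ∀ s ∈ S x, ‖mfderiv 𝓘(ℝ, E) 𝓘(ℝ, E) g x s‖ ≤ c * ‖s‖) (v : E) :
    ‖coordDeriv g p q x (splitProj h p x v)‖ ≤ C ^ 3 * c * ‖v‖ := by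
  set s := tangentCoordSymm p x (splitProj h p x v) with hs
  have hsS : s ∈ S x := by
    rw [hs, splitProj_apply, tangentCoordSymm_tangentCoord hx.mem_source]
    exact Submodule.projection_apply_mem _ _
  rw [coordDeriv_apply]
  calc _ ≤ C * ‖mfderiv 𝓘(ℝ, E) 𝓘(ℝ, E) g x s‖ := hgx.norm_tangentCoord_le _
    _ ≤ C * (c * ‖s‖) := by gcongr; exact hg s hsS
    _ ≤ C * (c * (C * ‖splitProj h p x v‖)) := by gcongr; exact hx.norm_tangentCoordSymm_le _
    _ ≤ C * (c * (C * (C * ‖v‖))) := by gcongr; exact hx.norm_splitProj_le _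
    _ = C ^ 3 * c * ‖v‖ := by ring

theorem ChartBounds.norm_coordDeriv_sub_splitProj_le {h : ∀ x, IsCompl (S x) (U x)} {C c : ℝ}
    {p q x : M} {g : M → M} (hC : 0 ≤ C) (hc : 0 ≤ c) (hx : ChartBounds h C p x)
    (hgx : ChartBounds h C q (g x))
    (hg : ∀ u ∈ U x, ‖mfderiv 𝓘(ℝ, E) 𝓘(ℝ, E) g x u‖ ≤ c * ‖u‖) (v : E) :
    ‖coordDeriv g p q x (v - splitProj h p x v)‖ ≤ C ^ 3 * c * ‖v‖ := by
  set u := tangentCoordSymm p x (v - splitProj h p x v) with hu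
  have huU : u ∈ U x := by
    rw [hu, map_sub, splitProj_apply, tangentCoordSymm_tangentCoord hx.mem_source,
      ← Submodule.projection_eq_self_sub_projection]
    exact Submodule.projection_apply_mem _ _
  rw [coordDeriv_apply]
  calc _ ≤ C * ‖mfderiv 𝓘(ℝ, E) 𝓘(ℝ, E) g x u‖ := hgx.norm_tangentCoord_le _
    _ ≤ C * (c * ‖u‖) := by gcongr; exact hg u huU
    _ ≤ C * (c * (C * ‖v - splitProj h p x v‖)) := by
        gcongr; exact hx.norm_tangentCoordSymm_le _
    _ ≤ C * (c * (C * (C * ‖v‖))) := by gcongr; exact hx.norm_sub_splitProj_le _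
    _ = C ^ 3 * c * ‖v‖ := by ring

variable [IsContinuousRiemannianBundle E (fun x : M => TangentSpace 𝓘(ℝ, E) x)]

omit [FiniteDimensional ℝ E] in
theorem eventually_norm_tangentCoord_le (p : M) :
    ∃ C : ℝ, ∀ᶠ x in 𝓝 p, ∀ v : TangentSpace 𝓘(ℝ, E) x, ‖tangentCoord p x v‖ ≤ C * ‖v‖ := by
  obtain ⟨C, -, h⟩ := eventually_norm_trivializationAt_lt E (fun x : M => TangentSpace 𝓘(ℝ, E) x) p
  refine ⟨C, h.mono fun x hx v => ?_⟩
  exact ((trivializationAt E (fun x : M => TangentSpace 𝓘(ℝ, E) x) p).continuousLinearMapAt ℝ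
    x).le_of_opNorm_le hx.le v

omit [FiniteDimensional ℝ E] in
theorem eventually_norm_tangentCoordSymm_le (p : M) :
    ∃ C : ℝ, ∀ᶠ x in 𝓝 p, ∀ v : E, ‖tangentCoordSymm p x v‖ ≤ C * ‖v‖ := by
  obtain ⟨C, -, h⟩ :=
    eventually_norm_symmL_trivializationAt_lt E (fun x : M => TangentSpace 𝓘(ℝ, E) x) p
  refine ⟨C, h.mono fun x hx v => ?_⟩
  exact ((trivializationAt E (fun x : M => TangentSpace 𝓘(ℝ, E) x) p).symmL ℝ
    x).le_of_opNorm_le hx.le v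

theorem eventually_chartBounds (h : ∀ x, IsCompl (S x) (U x)) (hS : IsContinuousSubspaceField S)
    (hU : IsContinuousSubspaceField U) (p : M) : ∃ C : ℝ, ∀ᶠ x in 𝓝 p, ChartBounds h C p x := by
  obtain ⟨C₁, h₁⟩ := eventually_norm_tangentCoord_le (E := E) p
  obtain ⟨C₂, h₂⟩ := eventually_norm_tangentCoordSymm_le (E := E) p
  have hc := continuousAt_splitProj hS hU h (mem_chart_source E p)
  have h₃ := hc.norm.eventually_lt_const (lt_add_one ‖splitProj h p p‖)
  have h₄ := (continuousAt_const (y := ContinuousLinearMap.id ℝ E)).sub hc |>.norm.eventually_lt_const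
    (lt_add_one ‖ContinuousLinearMap.id ℝ E - splitProj h p p‖)
  set C₃ := ‖splitProj h p p‖ + 1
  set C₄ := ‖ContinuousLinearMap.id ℝ E - splitProj h p p‖ + 1
  refine ⟨max (max C₁ C₂) (max C₃ C₄), ?_⟩
  filter_upwards [h₁, h₂, h₃, h₄, (chartAt E p).open_source.mem_nhds (mem_chart_source E p)]
    with x h₁ h₂ h₃ h₄ hx
  refine ⟨hx, fun v => ?_, fun v => ?_, fun v => ?_, fun v => ?_⟩
  · exact (h₁ v).trans (by gcongr; simp)
  · exact (h₂ v).trans (by gcongr; simp)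
  · exact (splitProj h p x).le_of_opNorm_le (h₃.le.trans (by simp)) v
  · exact (ContinuousLinearMap.id ℝ E - splitProj h p x).le_of_opNorm_le (h₄.le.trans (by simp)) v

/-- The smaller sets `K p` contain the pseudo-orbit points; the larger `K' p` leave room for the
nearby points `g (x n)`, read in the chart of `x (n + 1)`. -/
theorem exists_chartBounds_cover [CompactSpace M] [T2Space M] (h : ∀ x, IsCompl (S x) (U x))
    (hS : IsContinuousSubspaceField S) (hU : IsContinuousSubspaceField U) :
    ∃ (C : ℝ) (Λ : Finset M) (K K' : M → Set M), 1 ≤ C ∧ (∀ p, IsCompact (K p)) ∧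
      (∀ p, IsCompact (K' p)) ∧ (∀ p, K p ⊆ interior (K' p)) ∧ (∀ x, ∃ p ∈ Λ, x ∈ K p) ∧
      ∀ p ∈ Λ, ∀ x ∈ K' p, ChartBounds h C p x := by
  have : LocallyCompactSpace M := inferInstance
  choose C hC using eventually_chartBounds h hS hU
  have hnhd : ∀ p : M, ∃ L : Set M, IsCompact L ∧ L ∈ 𝓝 p ∧ ∀ x ∈ L, ChartBounds h (C p) p x := by
    intro p
    obtain ⟨L, hL, hLs, hLc⟩ := local_compact_nhds (hC p)
    exact ⟨L, hLc, hL, hLs⟩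
  choose K' hK'c hK'n hK' using hnhd
  have hnhd' : ∀ p : M, ∃ L : Set M, IsCompact L ∧ L ∈ 𝓝 p ∧ L ⊆ interior (K' p) := by
    intro p
    obtain ⟨L, hL, hLs, hLc⟩ := local_compact_nhds (interior_mem_nhds.2 (hK'n p))
    exact ⟨L, hLc, hL, hLs⟩
  choose K hKc hKn hK using hnhd'
  obtain ⟨Λ, hΛ⟩ := CompactSpace.elim_nhds_subcover K hKn
  obtain ⟨B, hB⟩ := (Λ.image C).exists_le
  refine ⟨max B 1, Λ, K, K', le_max_right _ _, hKc, hK'c, hK, fun x => ?_, fun p hp x hx => ?_⟩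
  · have : x ∈ ⋃ p ∈ Λ, K p := by rw [hΛ]; trivial
    simpa using this
  · exact (hK' p x hx).mono ((hB _ (Finset.mem_image_of_mem C hp)).trans (le_max_left _ _))

end Cover

/-! ### Shadowing lemma on the manifold -/

section Shadow

variable {E : Type*} [NormedAddCommGroup E] [NormedSpace ℝ E]
  {M : Type*} [UniformSpace M] [T2Space M] [ChartedSpace E M]
  {Λ : Finset M} {K K' : M → Set M} {g : M → M}

omit [NormedSpace ℝ E] in
theorem isCompact_chartAt_image_inter (hK : ∀ p, IsCompact (K p)) (hK' : ∀ p, IsCompact (K' p))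
    (hg : Continuous g) {p q : M} (hp : K p ⊆ (chartAt E p).source) :
    IsCompact (chartAt E p '' (K p ∩ g ⁻¹' (K' q))) :=
  ((hK p).inter_right ((hK' q).isClosed.preimage hg)).image_of_continuousOn
    ((chartAt E p).continuousOn.mono (inter_subset_left.trans hp))

omit [T2Space M] in
theorem chartAt_image_inter_subset_chartDomain {p q : M} (hp : K p ⊆ (chartAt E p).source)
    (hq : K' q ⊆ (chartAt E q).source) :
    chartAt E p '' (K p ∩ g ⁻¹' (K' q)) ⊆ chartDomain E g p q := by
  rintro _ ⟨x, hx, rfl⟩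
  exact chartAt_mem_chartDomain (hp hx.1) (hq hx.2)

omit [NormedSpace ℝ E] [T2Space M] in
theorem exists_radius_chartAt_symm {V : Set (M × M)} (hV : V ∈ 𝓤 M) (hK : ∀ p, IsCompact (K p))
    (hp : ∀ p ∈ Λ, K p ⊆ (chartAt E p).source) : ∃ r : ℝ, 0 < r ∧ ∀ p ∈ Λ, ∀ x ∈ K p, ∀ v : E,
      ‖v‖ ≤ r → (x, (chartAt E p).symm (chartAt E p x + v)) ∈ V := by
  refine exists_pos_forall_finset Λ _ (fun p r r' hr h x hx v hv => h x hx v (hv.trans hr)) ?_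
  intro p hpΛ
  have hcomp : IsCompact (chartAt E p '' K p) :=
    (hK p).image_of_continuousOn ((chartAt E p).continuousOn.mono (hp p hpΛ))
  have hunif := hcomp.uniformContinuousAt_of_continuousAt (chartAt E p).symm (by
    rintro _ ⟨x, hx, rfl⟩
    exact (chartAt E p).continuousAt_symm ((chartAt E p).map_source (hp p hpΛ hx))) hV
  obtain ⟨r, hr, h⟩ := Metric.mem_uniformity_dist.1 hunif
  refine ⟨r / 2, by positivity, fun x hx v hv => ?_⟩
  have hd : dist (chartAt E p x) (chartAt E p x + v) < r := by
    rw [dist_self_add_right]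
    linarith
  have := h hd ⟨x, hx, rfl⟩
  rwa [(chartAt E p).left_inv (hp p hpΛ hx)] at this

variable [IsManifold 𝓘(ℝ, E) 1 M]

theorem exists_norm_coordDeriv_le (hK : ∀ p, IsCompact (K p)) (hK' : ∀ p, IsCompact (K' p))
    (hp : ∀ p ∈ Λ, K p ⊆ (chartAt E p).source) (hp' : ∀ p ∈ Λ, K' p ⊆ (chartAt E p).source)
    (hg : ContMDiff 𝓘(ℝ, E) 𝓘(ℝ, E) 1 g) :
    ∃ a : ℝ, 0 ≤ a ∧ ∀ p ∈ Λ, ∀ q ∈ Λ, ∀ x ∈ K p, g x ∈ K' q → ∀ v : E,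
      ‖coordDeriv g p q x v‖ ≤ a * ‖v‖ := by
  -- Membership in `Λ ×ˢ Λ` sits under the existential so that a bound can be chosen for every pair.
  have hex : ∀ i : M × M, ∃ b : ℝ, i ∈ Λ ×ˢ Λ → ∀ x ∈ K i.1, g x ∈ K' i.2 →
      ‖coordDeriv (E := E) g i.1 i.2 x‖ ≤ b := by
    rintro ⟨p, q⟩
    by_cases hpq : (p, q) ∈ Λ ×ˢ Λ
    · obtain ⟨hpΛ, hqΛ⟩ := Finset.mem_product.1 hpq
      obtain ⟨b, hb⟩ := (isCompact_chartAt_image_inter (q := q) hK hK' hg.continuous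
        (hp p hpΛ)).exists_bound_of_continuousOn (f := fderiv ℝ (chartMap g p q)) (fun u hu =>
        (((contDiffAt_chartMap hg (chartAt_image_inter_subset_chartDomain (hp p hpΛ) (hp' q hqΛ)
          hu)).fderiv_right (m := 0) (by norm_num)).continuousAt).continuousWithinAt)
      refine ⟨b, fun _ x hx hgx => ?_⟩
      have := hb _ ⟨x, ⟨hx, hgx⟩, rfl⟩
      rwa [fderiv_chartMap (hg.mdifferentiable one_ne_zero) (hp p hpΛ hx) (hp' q hqΛ hgx)] at this
    · exact ⟨0, fun h => absurd h hpq⟩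
  choose b hb using hex
  obtain ⟨B, hB⟩ := ((Λ ×ˢ Λ).image b).exists_le
  refine ⟨max B 0, le_max_right _ _, fun p hpΛ q hqΛ x hx hgx v => ?_⟩
  have hpq : (p, q) ∈ Λ ×ˢ Λ := Finset.mk_mem_product hpΛ hqΛ
  exact (coordDeriv g p q x).le_of_opNorm_le ((hb (p, q) hpq x hx hgx).trans
    ((hB _ (Finset.mem_image_of_mem b hpq)).trans (le_max_left _ _))) v

theorem exists_radius_chartMap (hK : ∀ p, IsCompact (K p)) (hK' : ∀ p, IsCompact (K' p))
    (hp : ∀ p ∈ Λ, K p ⊆ (chartAt E p).source) (hp' : ∀ p ∈ Λ, K' p ⊆ (chartAt E p).source)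
    (hg : ContMDiff 𝓘(ℝ, E) 𝓘(ℝ, E) 1 g) {η : ℝ} (hη : 0 < η) :
    ∃ r : ℝ, 0 < r ∧ ∀ p ∈ Λ, ∀ q ∈ Λ, ∀ x ∈ K p, g x ∈ K' q → ∀ v : E, ‖v‖ ≤ r →
      chartAt E p x + v ∈ chartDomain E g p q ∧ ∀ w : E, ‖w‖ ≤ r →
      ‖chartMap g p q (chartAt E p x + v) - chartMap g p q (chartAt E p x + w) -
        coordDeriv g p q x (v - w)‖ ≤ η * ‖v - w‖ := by
  refine Exists.imp ?_ (exists_pos_forall_finset (Λ ×ˢ Λ) (fun i r => ∀ x ∈ K i.1, g x ∈ K' i.2 →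
      ∀ v : E, ‖v‖ ≤ r → chartAt E i.1 x + v ∈ chartDomain E g i.1 i.2 ∧ ∀ w : E, ‖w‖ ≤ r →
      ‖chartMap g i.1 i.2 (chartAt E i.1 x + v) - chartMap g i.1 i.2 (chartAt E i.1 x + w) -
        coordDeriv g i.1 i.2 x (v - w)‖ ≤ η * ‖v - w‖)
    (fun i r r' hr h x hx hgx v hv => ⟨(h x hx hgx v (hv.trans hr)).1, fun w hw =>
      (h x hx hgx v (hv.trans hr)).2 w (hw.trans hr)⟩) ?_)
  · rintro r ⟨hr, h⟩
    exact ⟨hr, fun p hpΛ q hqΛ => h (p, q) (Finset.mk_mem_product hpΛ hqΛ)⟩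
  · rintro ⟨p, q⟩ hpq
    obtain ⟨hpΛ, hqΛ⟩ := Finset.mem_product.1 hpq
    obtain ⟨r, hr, h⟩ := exists_uniform_linear_approx (isOpen_chartDomain hg.continuous p q)
      (isCompact_chartAt_image_inter (q := q) hK hK' hg.continuous (hp p hpΛ))
      (chartAt_image_inter_subset_chartDomain (hp p hpΛ) (hp' q hqΛ))
      (fun u hu => contDiffAt_chartMap hg hu) hη
    refine ⟨r, hr, fun x hx hgx v hv => ?_⟩
    have := h _ ⟨x, ⟨hx, hgx⟩, rfl⟩ v hv
    rwa [fderiv_chartMap (hg.mdifferentiable one_ne_zero) (hp p hpΛ hx) (hp' q hqΛ hgx)] at this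

variable [FiniteDimensional ℝ E] {S U : ∀ x : M, Submodule ℝ (TangentSpace 𝓘(ℝ, E) x)}

-- Determines how small the jumps must be: the jump size becomes `α` in the chart, and the change of
-- the projection is at most `κ`.
omit [T2Space M] in
theorem exists_entourage_chartAt (hK : ∀ p, IsCompact (K p)) (hKK' : ∀ p, K p ⊆ interior (K' p))
    (hp : ∀ p ∈ Λ, K p ⊆ (chartAt E p).source) (h : ∀ x, IsCompl (S x) (U x))
    (hS : IsContinuousSubspaceField S) (hU : IsContinuousSubspaceField U) {α κ : ℝ}
    (hα : 0 < α) (hκ : 0 < κ) :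
    ∃ D ∈ 𝓤 M, ∀ y y' : M, (y, y') ∈ D → ∀ q ∈ Λ, y ∈ K q → y' ∈ K' q ∧
      ‖chartAt E q y' - chartAt E q y‖ ≤ α ∧
      ∀ v : E, ‖splitProj h q y v - splitProj h q y' v‖ ≤ κ * ‖v‖ := by
  have h1 : ∀ q ∈ Λ, {x : M × M | x.1 ∈ K q → x.2 ∈ K' q} ∈ 𝓤 M := by
    intro q hq
    obtain ⟨W, hW, hWK⟩ := (hK q).nhdsSet_basis_uniformity (𝓤 M).basis_sets |>.mem_iff.1
      (isOpen_interior.mem_nhdsSet.2 (hKK' q))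
    filter_upwards [hW] with x hx hx1
    exact interior_subset (hWK (mem_iUnion₂.2 ⟨x.1, hx1, hx⟩))
  have h2 : ∀ q ∈ Λ, {x : M × M | x.1 ∈ K q →
      (chartAt E q x.1, chartAt E q x.2) ∈ {z : E × E | dist z.1 z.2 < α}} ∈ 𝓤 M := fun q hq =>
    (hK q).uniformContinuousAt_of_continuousAt (chartAt E q)
      (fun x hx => (chartAt E q).continuousAt (hp q hq hx)) (Metric.dist_mem_uniformity hα)
  have h3 : ∀ q ∈ Λ, {x : M × M | x.1 ∈ K q → (splitProj h q x.1, splitProj h q x.2) ∈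
      {z : (E →L[ℝ] E) × (E →L[ℝ] E) | dist z.1 z.2 < κ}} ∈ 𝓤 M := fun q hq =>
    (hK q).uniformContinuousAt_of_continuousAt (splitProj h q)
      (fun x hx => continuousAt_splitProj hS hU h (hp q hq hx)) (Metric.dist_mem_uniformity hκ)
  refine ⟨_, inter_mem ((biInter_finset_mem Λ).2 h1)
    (inter_mem ((biInter_finset_mem Λ).2 h2) ((biInter_finset_mem Λ).2 h3)), ?_⟩
  rintro y y' ⟨hy1, hy2, hy3⟩ q hq hyq
  refine ⟨mem_iInter₂.1 hy1 q hq hyq, ?_, fun v => ?_⟩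
  · have : dist _ _ < α := mem_iInter₂.1 hy2 q hq hyq
    rw [dist_comm, dist_eq_norm] at this
    exact this.le
  · have : dist _ _ < κ := mem_iInter₂.1 hy3 q hq hyq
    rw [dist_eq_norm] at this
    exact (splitProj h q y - splitProj h q y').le_of_opNorm_le this.le v

variable [RiemannianBundle (fun x : M => TangentSpace 𝓘(ℝ, E) x)]

/-- Shadowing lemma for a diffeomorphism `g` with inverse `k` which strongly contracts `S` and
strongly expands `U`. -/
theorem exists_shadow {h : ∀ x, IsCompl (S x) (U x)} (hS : IsContinuousSubspaceField S)
    (hU : IsContinuousSubspaceField U) {C c : ℝ} (hC : 1 ≤ C) (hc : 0 ≤ c)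
    (hCc : C ^ 3 * c ≤ 1 / 8) (hK : ∀ p, IsCompact (K p)) (hK' : ∀ p, IsCompact (K' p))
    (hKK' : ∀ p, K p ⊆ interior (K' p)) (hcover : ∀ x, ∃ p ∈ Λ, x ∈ K p)
    (hbound : ∀ p ∈ Λ, ∀ x ∈ K' p, ChartBounds h C p x) {k : M → M}
    (hg : ContMDiff 𝓘(ℝ, E) 𝓘(ℝ, E) 1 g) (hk : ContMDiff 𝓘(ℝ, E) 𝓘(ℝ, E) 1 k)
    (hgk : ∀ x, g (k x) = x) (hkg : ∀ x, k (g x) = x)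
    (hgS : ∀ x, (S x).map (mfderiv 𝓘(ℝ, E) 𝓘(ℝ, E) g x).toLinearMap = S (g x))
    (hgU : ∀ x, (U x).map (mfderiv 𝓘(ℝ, E) 𝓘(ℝ, E) g x).toLinearMap = U (g x))
    (hs : ∀ x, ∀ s ∈ S x, ‖mfderiv 𝓘(ℝ, E) 𝓘(ℝ, E) g x s‖ ≤ c * ‖s‖)
    (hu : ∀ x, ∀ u ∈ U x, ‖mfderiv 𝓘(ℝ, E) 𝓘(ℝ, E) k x u‖ ≤ c * ‖u‖)
    {V : Set (M × M)} (hV : V ∈ 𝓤 M) :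
    ∃ D ∈ 𝓤 M, ∀ x : ℤ → M, (∀ n, (x (n + 1), g (x n)) ∈ D) →
      ∃ z : ℤ → M, (∀ n, z (n + 1) = g (z n)) ∧ ∀ n, (x n, z n) ∈ V := by
  have hC0 : 0 ≤ C := by linarith
  have hp' : ∀ p ∈ Λ, K' p ⊆ (chartAt E p).source := fun p hp x hx => (hbound p hp x hx).mem_source
  have hKsub : ∀ p, K p ⊆ K' p := fun p => (hKK' p).trans interior_subset
  have hp : ∀ p ∈ Λ, K p ⊆ (chartAt E p).source := fun p hp => (hKsub p).trans (hp' p hp)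
  have hgd := hg.mdifferentiable one_ne_zero
  have hkd := hk.mdifferentiable one_ne_zero
  obtain ⟨a, ha, hA⟩ := exists_norm_coordDeriv_le hK hK' hp hp' hg
  -- With `θ = C ^ 3 * c ≤ 1 / 8`, `κ * a ≤ 1 / 16` and `C * η = 1 / 16`, the contraction factor is
  -- at most `1 / 4 + 17 / 128 < 1 / 2`.
  set κ : ℝ := 1 / (16 * (a + 1)) with hκ_def
  have hκ : 0 < κ := by positivity
  have hκa : κ * a ≤ 1 / 16 := by
    rw [hκ_def, div_mul_eq_mul_div, one_mul, div_le_div_iff₀ (by positivity) (by norm_num)]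
    linarith
  have hκ1 : κ < 1 := by
    rw [hκ_def, div_lt_one (by positivity)]
    linarith
  set η : ℝ := 1 / (16 * C) with hη_def
  have hη : 0 < η := by positivity
  have hCη : C * η = 1 / 16 := by
    rw [hη_def]
    field_simp
  have hη1 : η ≤ 1 / 16 := by nlinarith
  obtain ⟨r₁, hr₁, hG⟩ := exists_radius_chartMap hK hK' hp hp' hg hη
  obtain ⟨r₂, hr₂, hr₂V⟩ := exists_radius_chartAt_symm hV hK hp
  -- `r₁` controls the linear approximation, `r₂` closeness in `V`. Then `α = R / (4 * C)` bounds
  -- the constant term by `R / 4 + R / 32`.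
  set R := min r₁ r₂ with hR_def
  have hR : 0 < R := by positivity
  set α := R / (4 * C) with hα_def
  have hα : 0 < α := by positivity
  have hCα : C * α = R / 4 := by
    rw [hα_def]
    field_simp
  obtain ⟨D, hD, hDprop⟩ := exists_entourage_chartAt hK hKK' hp h hS hU hα hκ
  refine ⟨D, hD, fun x hx => ?_⟩
  choose p hpΛ hpK using fun n => hcover (x n)
  have hstep := fun n => hDprop _ _ (hx n) (p (n + 1)) (hpΛ _) (hpK _)
  have hb : ∀ n, ChartBounds h C (p n) (x n) := fun n => hbound _ (hpΛ n) _ (hKsub _ (hpK n))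
  have hb' : ∀ n, ChartBounds h C (p (n + 1)) (g (x n)) := fun n =>
    hbound _ (hpΛ _) _ (hstep n).1
  have hkb : ∀ n, ChartBounds h C (p n) (k (g (x n))) := fun n => by rw [hkg]; exact hb n
  have hAk : ∀ n v, coordDeriv k (p (n + 1)) (p n) (g (x n))
      (coordDeriv g (p n) (p (n + 1)) (x n) v) = v := fun n v =>
    coordDeriv_coordDeriv_of_inverse hkd hgd hkg (hb n).mem_source (hb' n).mem_source v
  have hkA : ∀ n v, coordDeriv g (p n) (p (n + 1)) (x n)
      (coordDeriv k (p (n + 1)) (p n) (g (x n)) v) = v := fun n v => by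
    have := coordDeriv_coordDeriv_of_inverse hgd hkd hgk (hb' n).mem_source (hkb n).mem_source v
    rwa [hkg] at this
  have hPA : ∀ n v, splitProj h (p (n + 1)) (g (x n)) (coordDeriv g (p n) (p (n + 1)) (x n) v) =
      coordDeriv g (p n) (p (n + 1)) (x n) (splitProj h (p n) (x n) v) := fun n v =>
    splitProj_coordDeriv h hgS hgU (hb n).mem_source (hb' n).mem_source v
  obtain ⟨v, hv, hvG⟩ := exists_bounded_orbit (E := E)
    (fun n => coordDeriv g (p n) (p (n + 1)) (x n))
    (fun n => coordDeriv k (p (n + 1)) (p n) (g (x n)) ∘L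
      (ContinuousLinearMap.id ℝ E - splitProj h (p (n + 1)) (g (x n))))
    (fun n => splitProj h (p n) (x n)) (fun n => splitProj h (p (n + 1)) (g (x n)))
    (fun n v => chartMap g (p n) (p (n + 1)) (chartAt E (p n) (x n) + v) -
      chartAt E (p (n + 1)) (x (n + 1)))
    (θ := C ^ 3 * c) (κ := κ) (a := a) (C := C) (η := η) (α := α) (R := R) hR.le hC0
    (by positivity) hη.le
    (fun n v => splitProj_splitProj h (hb n).mem_source v) hPA
    (fun n v => (hb n).norm_coordDeriv_splitProj_le hC0 hc (hb' n) (hs _) v)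
    (fun n v => (hb' n).norm_coordDeriv_sub_splitProj_le hC0 hc (hkb n) (hu _) v)
    (fun n v => hkA n _)
    (fun n v => by
      -- `A n` is injective, and `A P B v = P' A B v = P' (v - P' v) = 0`.
      have hz : ∀ w : E, coordDeriv g (p n) (p (n + 1)) (x n) w = 0 → w = 0 := fun w hw => by
        rw [← hAk n w, hw, map_zero]
      refine hz _ ?_
      rw [← hPA]
      simp only [ContinuousLinearMap.comp_apply, hkA, sub_apply,
        ContinuousLinearMap.id_apply, map_sub, splitProj_splitProj h (hb' n).mem_source, sub_self])
    (fun n v => (hb n).norm_splitProj_le v) (fun n v => (hstep n).2.2 v) hκ.le hκ1 ha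
    (fun n v => hA _ (hpΛ _) _ (hpΛ _) _ (hpK n) (hstep n).1 v)
    (fun n v w hv hw => by
      have := (hG _ (hpΛ _) _ (hpΛ _) _ (hpK n) (hstep n).1 v (hv.trans (min_le_left _ _))).2 w
        (hw.trans (min_le_left _ _))
      simpa using this)
    (fun n => by
      have := (hstep n).2.1
      simpa [chartMap, (chartAt E (p n)).left_inv (hb n).mem_source] using this)
    (by nlinarith) (by nlinarith)
  refine ⟨fun n => (chartAt E (p n)).symm (chartAt E (p n) (x n) + v n), fun n => ?_, fun n =>
    hr₂V _ (hpΛ n) _ (hpK n) _ ((hv n).trans (min_le_right _ _))⟩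
  -- Ensures that `g (z n)` lies in the chart at `p (n + 1)`, where the inverse chart recovers it.
  have hdom := (hG _ (hpΛ n) _ (hpΛ (n + 1)) _ (hpK n) (hstep n).1 (v n)
    ((hv n).trans (min_le_left _ _))).1
  simp only [hvG n, add_sub_cancel]
  exact (chartAt E (p (n + 1))).left_inv hdom.2

end Shadow

/-! ### Existence of the intersection point -/

section Main

variable {E : Type*} [NormedAddCommGroup E] [NormedSpace ℝ E]
  {M : Type*} [EMetricSpace M] [ChartedSpace E M]

/-- If a pseudo-orbit of `f ^ N` with a single jump from `y` to `x` at time `0` is shadowed by the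
orbit of `w`, then `w` lies in the stable set of `x` and in the unstable set of `y`. -/
theorem mem_stableSet_inter_unstableSet_of_shadow {f : M ≃ₘ^1⟮𝓘(ℝ, E), 𝓘(ℝ, E)⟯ M} {N : ℤ}
    (hN : 0 < N) {ε : ℝ} (hε : 0 ≤ ε) {x y w : M}
    (hxy : edist x y ≤ ENNReal.ofReal (ε / 2))
    (hx : ∀ n : ℤ, 0 ≤ n → ∀ j : ℤ, 0 ≤ j → j < N →
      edist (iter f j (iter f (N * n) x)) (iter f j (iter f (N * n) w)) ≤ ENNReal.ofReal (ε / 2))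
    (hy : ∀ n : ℤ, n < 0 → ∀ j : ℤ, 0 ≤ j → j < N →
      edist (iter f j (iter f (N * n) y)) (iter f j (iter f (N * n) w)) ≤ ENNReal.ofReal (ε / 2)) :
    w ∈ stableSet f ε x ∩ unstableSet f ε y := by
  have hle : ENNReal.ofReal (ε / 2) ≤ ENNReal.ofReal ε := ENNReal.ofReal_le_ofReal (by linarith)
  -- Division rounds down, so negative times have negative quotient and a remainder in `[0, N)`.
  have hdiv : ∀ (m : ℤ) (a : M), iter f m a = iter f (m % N) (iter f (N * (m / N)) a) :=
    fun m a => by rw [← iter_add_apply, Int.emod_add_mul_ediv]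
  refine ⟨fun m hm => ?_, fun m hm => ?_⟩
  · rw [hdiv m x, hdiv m w]
    exact (hx _ (Int.ediv_nonneg hm hN.le) _ (Int.emod_nonneg m hN.ne')
      (Int.emod_lt_of_pos m hN)).trans hle
  · rcases hm.lt_or_eq with hm | rfl
    · rw [hdiv m y, hdiv m w]
      exact (hy _ (Int.ediv_neg_of_neg_of_pos hm hN) _ (Int.emod_nonneg m hN.ne')
        (Int.emod_lt_of_pos m hN)).trans hle
    -- Time `0` follows `x`, not `y`; the jump costs the second `ε / 2`.
    · have h0 := hx 0 le_rfl 0 le_rfl hN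
      simp only [mul_zero, iter_zero, id] at h0 ⊢
      calc edist y w ≤ edist x y + edist x w := edist_triangle_left _ _ _
        _ ≤ ENNReal.ofReal (ε / 2) + ENNReal.ofReal (ε / 2) := add_le_add hxy h0
        _ = ENNReal.ofReal ε := by
          rw [← ENNReal.ofReal_add (by linarith) (by linarith), add_halves]

variable [FiniteDimensional ℝ E] [CompactSpace M] [IsManifold 𝓘(ℝ, E) 1 M]
  [RiemannianBundle (fun x : M => TangentSpace 𝓘(ℝ, E) x)]
  [IsContinuousRiemannianBundle E (fun x : M => TangentSpace 𝓘(ℝ, E) x)]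

/-- An iterate of an Anosov diffeomorphism has the shadowing property. -/
theorem exists_iterate_shadow {f : M ≃ₘ^1⟮𝓘(ℝ, E), 𝓘(ℝ, E)⟯ M} (hf : IsAnosov f) :
    ∃ N : ℕ, 0 < N ∧ ∀ V ∈ 𝓤 M, ∃ D ∈ 𝓤 M, ∀ x : ℤ → M, (∀ n, (x (n + 1), iter f N (x n)) ∈ D) →
      ∃ z : ℤ → M, (∀ n, z (n + 1) = iter f N (z n)) ∧ ∀ n, (x n, z n) ∈ V := by
  obtain ⟨L, lam, S, U, hL, hlam, hlam1, hS, hU, hSU, hfS, hfU, hs, hu⟩ := hf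
  obtain ⟨C, Λ, K, K', hC, hK, hK', hKK', hcover, hbound⟩ := exists_chartBounds_cover hSU hS hU
  have hlim : Tendsto (fun n : ℕ => C ^ 3 * (L * lam ^ n)) atTop (𝓝 0) := by
    simpa using ((tendsto_pow_atTop_nhds_zero_of_lt_one hlam.le hlam1).const_mul L).const_mul (C ^ 3)
  obtain ⟨N, hN, hN0⟩ := ((hlim.eventually_le_const (show (0 : ℝ) < 1 / 8 by norm_num)).and
    (eventually_gt_atTop 0)).exists
  exact ⟨N, hN0, fun V hV => exists_shadow hS hU hC (by positivity) hN hK hK' hKK' hcover hbound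
    (contMDiff_iter f N) (contMDiff_iter f (-N)) (iter_iter_neg f N) (iter_neg_iter f N)
    (map_mfderiv_iter f hfS N) (map_mfderiv_iter f hfU N) (fun x => hs x N) (fun x => hu x N) hV⟩

theorem exists_mem_stableSet_inter_unstableSet {f : M ≃ₘ^1⟮𝓘(ℝ, E), 𝓘(ℝ, E)⟯ M} (hf : IsAnosov f)
    {ε : ℝ} (hε : 0 < ε) : ∃ δ : ℝ, 0 < δ ∧ ∀ x y : M, edist x y < ENNReal.ofReal δ →
      (stableSet f ε x ∩ unstableSet f ε y).Nonempty := by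
  obtain ⟨N, hN, hshadow⟩ := exists_iterate_shadow hf
  have hN' : (0 : ℤ) < N := by exact_mod_cast hN
  -- Shadowing controls only multiples of `N`; this entourage also controls the `N - 1` iterates in
  -- between.
  have hV : (⋂ j ∈ Finset.range N, {p : M × M |
      edist (iter f j p.1) (iter f j p.2) < ENNReal.ofReal (ε / 2)}) ∈ 𝓤 M :=
    (biInter_finset_mem _).2 fun j _ =>
      (CompactSpace.uniformContinuous_of_continuous (contMDiff_iter f j).continuous)
        (edist_mem_uniformity (by simpa using hε))
  obtain ⟨D, hD, hshadow⟩ := hshadow _ hV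
  obtain ⟨e, he, heD⟩ := mem_uniformity_edist.1 hD
  obtain ⟨d, hd0, hde⟩ := ENNReal.lt_iff_exists_real_btwn.1 he
  have hd : 0 < d := by simpa using hde.1
  refine ⟨min d (ε / 2), by positivity, fun x y hxy => ?_⟩
  set X : ℤ → M := fun n => if 0 ≤ n then iter f (N * n) x else iter f (N * n) y with hX
  have hXpos : ∀ n, 0 ≤ n → X n = iter f (N * n) x := fun n hn => by simp [hX, hn]
  have hXneg : ∀ n, n < 0 → X n = iter f (N * n) y := fun n hn => by simp [hX, hn]
  have hsucc : ∀ (n : ℤ) (a : M), iter f N (iter f (N * n) a) = iter f (N * (n + 1)) a :=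
    fun n a => by rw [← iter_add_apply]; congr 1; ring
  obtain ⟨z, hz, hzV⟩ := hshadow X fun n => by
    rcases lt_trichotomy (n + 1) 0 with hn | hn | hn
    · rw [hXneg _ hn, hXneg n (by omega), hsucc]
      exact refl_mem_uniformity hD
    -- The only jump, at `n = -1`: the image of the previous point is `y`, the next point is `x`.
    · rw [hXpos _ hn.ge, hXneg n (by omega), hsucc, hn, mul_zero, iter_zero]
      exact heD (hxy.trans_le ((ENNReal.ofReal_le_ofReal (min_le_left _ _)).trans hde.2.le))
    · rw [hXpos _ hn.le, hXpos n (by omega), hsucc]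
      exact refl_mem_uniformity hD
  have hclose : ∀ n j : ℤ, 0 ≤ j → j < N →
      edist (iter f j (X n)) (iter f j (iter f (N * n) (z 0))) ≤ ENNReal.ofReal (ε / 2) := by
    intro n j hj hjN
    lift j to ℕ using hj
    have h := mem_iInter₂.1 (hzV n) j (Finset.mem_range.2 (by exact_mod_cast hjN))
    rw [eq_iter_of_succ f N hz n] at h
    exact h.le
  refine ⟨z 0, mem_stableSet_inter_unstableSet_of_shadow hN' hε.le
    (hxy.le.trans (ENNReal.ofReal_le_ofReal (min_le_right _ _))) (fun n hn j hj hjN => ?_)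
    (fun n hn j hj hjN => ?_)⟩
  · rw [← hXpos n hn]
    exact hclose n j hj hjN
  · rw [← hXneg n hn]
    exact hclose n j hj hjN

end Main

end AnosovBracket

theorem mainTheorem5
    {E : Type*} [NormedAddCommGroup E] [NormedSpace ℝ E] [FiniteDimensional ℝ E]
    {M : Type*} [EMetricSpace M] [CompactSpace M] [ChartedSpace E M]
    [IsManifold 𝓘(ℝ, E) 1 M]
    [RiemannianBundle (fun x : M => TangentSpace 𝓘(ℝ, E) x)]
    [IsContinuousRiemannianBundle E (fun x : M => TangentSpace 𝓘(ℝ, E) x)]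
    [IsRiemannianManifold 𝓘(ℝ, E) M]
    (f : M ≃ₘ^1⟮𝓘(ℝ, E), 𝓘(ℝ, E)⟯ M) (hf : AnosovBracket.IsAnosov f)
    (ρ : ℝ) (hρ : AnosovBracket.IsExpansivityConstant f ρ)
    (ε : ℝ) (hε : 0 < ε) (hερ : ε ≤ ρ / 2) :
    (∃ δ : ℝ, 0 < δ ∧ AnosovBracket.UniqueIntersection f ε δ) ∧
    ∀ (δ : ℝ), 0 < δ → ∀ h : AnosovBracket.UniqueIntersection f ε δ,
      Continuous (AnosovBracket.bracket f ε δ h) := by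
  refine ⟨?_, fun δ _ h => AnosovBracket.continuous_bracket f ε δ h⟩
  obtain ⟨δ, hδ, hex⟩ := AnosovBracket.exists_mem_stableSet_inter_unstableSet hf hε
  refine ⟨δ, hδ, fun x y hxy => ?_⟩
  obtain ⟨z, hz⟩ := hex x y hxy
  exact ⟨z, eq_singleton_iff_unique_mem.2 ⟨hz, fun w hw =>
    AnosovBracket.eq_of_mem_stableSet_inter_unstableSet hρ hε.le hερ hw hz⟩⟩
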